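/- Let $d\ge 1$, $D=d(d+1)/2$ and $n\in\mathbb N$. For $x\in\mathbb R^d$ let $x\otimes_S x\in\mathbb R^D$ be the vector of the upper triangular entries of $xx^T$. An $m\times n$ matrix $S$ is a selection matrix if each of its rows is of the form $s_{(p,q)}$ with distinct $p,q\in[n]$, where $s_{(p,q)}$ has entry $1$ at $p$, $-1$ at $q$ and $0$ elsewhere. For $K$ users with selection matrices $S_1,\dots,S_K$ and items $x_1,\dots,x_n\in\mathbb R^d$, put $X=[x_1,\dots,x_n]$ and $X_\otimes=[x_1\otimes_S x_1,\dots,x_n\otimes_S x_n]$; the measurement matrix $\Gamma$ has $D+dK$ columns, and the block of rows of user $k$ is $[\,S_kX_\otimes^T,\,0,\dots,0,\,S_kX^T,\,0,\dots,0\,]$, with $S_kX^T$ in the $k$-th of the $K$ blocks of $d$ columns. For one user ($K=1$, $S_1=S$), $\Gamma=S\,[X_\otimes^T\ \ X^T]$. Identifiability means that $\Gamma$ has full column rank, i.e. linearly independent columns. Let $K=1$. (1) For every $m$, every $m\times n$ selection matrix $S$ and all items $x_1,\dots,x_n$: if $\Gamma$ has full column rank, then $\operatorname{rank}(S)\ge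 D+d$. (2) Let $S$ be a fixed $m\times n$ selection matrix, and let $x_1,\dots,x_n$ be i.i.d. with law $p_X$ absolutely continuous with respect to Lebesgue measure on $\mathbb R^d$. Then $\Gamma$ has full column rank almost surely if and only if $\operatorname{rank}(S)\ge D+d$. (3) Let $0<\delta<1$, $n\ge\frac{1+\sqrt5}{2}(D+d)+1$ and $m\ge\left\lceil\frac{1+\sqrt5}{2}\left(1+\ln\frac1\delta\right)(D+d-1)\right\rceil+1$. Let $(p_1,q_1),\dots,(p_m,q_m)$ be independent and uniformly distributed on the ordered pairs of distinct elements of $[n]$, and let $S$ be the selection matrix with rows $s_{(p_i,q_i)}$. Then $\mathbb P(\operatorname{rank}(S)\ge D+d)\ge 1-\delta$. If moreover $x_1,\dots,x_n$ are i.i.d. with an absolutely continuous law $p_X$, independently of the pairs, then $\Gamma$ has full column rank with probability at least $1-\delta$. -/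

import Mathlib

open MeasureTheory ProbabilityTheory Matrix

noncomputable section

namespace MetricPreference

/-- The dimension `D = d (d + 1) / 2` of the space of symmetric `d × d` matrices. -/
def metricDim (d : ℕ) : ℕ := d * (d + 1) / 2

/-- Positions on or above the diagonal of a `d × d` matrix; there are `D` of them. -/
abbrev UpperIndex (d : ℕ) : Type := {a : Fin d × Fin d // a.1 ≤ a.2}

theorem card_upperIndex (d : ℕ) : Fintype.card (UpperIndex d) = metricDim d := by
  rw [← Fintype.card_congr (Sym2.sortEquiv (α := Fin d)), Sym2.card, Fintype.card_fin,
    Nat.choose_two_right, metricDim, Nat.add_sub_cancel, Nat.mul_comm]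

/-- The symmetric tensor square `x ⊗_S x`: the upper triangular entries of `x xᵀ`. -/
def symSquare {d : ℕ} (x : EuclideanSpace ℝ (Fin d)) (a : UpperIndex d) : ℝ :=
  x a.1.1 * x a.1.2

/-- The matrix `X = [x_1, …, x_n]`, whose columns are the items. -/
def itemMatrix {n d : ℕ} (x : Fin n → EuclideanSpace ℝ (Fin d)) : Matrix (Fin d) (Fin n) ℝ :=
  Matrix.of fun c j => x j c

/-- The matrix `X_⊗ = [x_1 ⊗_S x_1, …, x_n ⊗_S x_n]`. -/
def itemTensorMatrix {n d : ℕ} (x : Fin n → EuclideanSpace ℝ (Fin d)) :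
    Matrix (UpperIndex d) (Fin n) ℝ :=
  Matrix.of fun a j => symSquare (x j) a

/-- The vector `s_(p,q)` with entry `1` at `p`, entry `-1` at `q` and zeros elsewhere. -/
def selectionRow {n : ℕ} (p q : Fin n) : Fin n → ℝ :=
  fun j => if j = p then 1 else if j = q then -1 else 0

/-- A selection matrix: each row is `s_(p,q)` for some distinct `p` and `q`. -/
def IsSelectionMatrix {m n : ℕ} (S : Matrix (Fin m) (Fin n) ℝ) : Prop :=
  ∀ i, ∃ p q : Fin n, p ≠ q ∧ S i = selectionRow p q

/-- Ordered pairs of distinct items. -/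
abbrev ItemPair (n : ℕ) : Type := {e : Fin n × Fin n // e.1 ≠ e.2}

/-- The selection matrix whose `i`-th row is `s_(p,q)`, where `(p, q)` is the `i`-th pair. -/
def selectionMatrix {m n : ℕ} (e : Fin m → ItemPair n) : Matrix (Fin m) (Fin n) ℝ :=
  Matrix.of fun i => selectionRow (e i).1.1 (e i).1.2

theorem isSelectionMatrix_selectionMatrix {m n : ℕ} (e : Fin m → ItemPair n) :
    IsSelectionMatrix (selectionMatrix e) :=
  fun i => ⟨(e i).1.1, (e i).1.2, (e i).2, rfl⟩

/-- The measurement matrix `Γ` for `K` users with selection matrices `S_1, …, S_K`: the block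
row of user `k` is `[S_k X_⊗ᵀ, 0, …, 0, S_k Xᵀ, 0, …, 0]`, with `S_k Xᵀ` in the `k`-th of the `K`
blocks of `d` columns. It has `m_1 + … + m_K` rows and `D + d K` columns. -/
def measurementMatrix {K n d : ℕ} {m : Fin K → ℕ} (S : ∀ k, Matrix (Fin (m k)) (Fin n) ℝ)
    (x : Fin n → EuclideanSpace ℝ (Fin d)) :
    Matrix (Σ k, Fin (m k)) (UpperIndex d ⊕ Fin K × Fin d) ℝ :=
  Matrix.of fun r => Sum.elim
    (fun a => (S r.1 * (itemTensorMatrix x)ᵀ) r.2 a)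
    (fun b => if b.1 = r.1 then (S r.1 * (itemMatrix x)ᵀ) r.2 b.2 else 0)

/-- The single-user (`K = 1`) measurement matrix. -/
def singleUserMatrix {m n d : ℕ} (S : Matrix (Fin m) (Fin n) ℝ)
    (x : Fin n → EuclideanSpace ℝ (Fin d)) :
    Matrix (Σ _ : Fin 1, Fin m) (UpperIndex d ⊕ Fin 1 × Fin d) ℝ :=
  measurementMatrix (K := 1) (m := fun _ => m) (fun _ => S) x

/-- A matrix has full column rank if its columns are linearly independent. -/
def FullColumnRank {ι κ : Type*} (A : Matrix ι κ ℝ) : Prop :=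
  LinearIndependent ℝ A.col

/-- The items `x_1, …, x_n` are independent with common law `pX`. -/
def IsIIDItems {Ω : Type*} [MeasurableSpace Ω] (P : Measure Ω) {n d : ℕ}
    (pX : Measure (EuclideanSpace ℝ (Fin d))) (X : Fin n → Ω → EuclideanSpace ℝ (Fin d)) : Prop :=
  (∀ j, HasLaw (X j) pX P) ∧ iIndepFun X P

/-- The pairs are independent and uniformly distributed on the ordered pairs of distinct items. -/
def IsIIDUniformPairs {Ω : Type*} [MeasurableSpace Ω] (P : Measure Ω) {m n : ℕ}
    (e : Fin m → Ω → ItemPair n) : Prop :=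
  (∀ i, HasLaw (e i) (uniformOn (Set.univ : Set (ItemPair n))) P) ∧ iIndepFun e P

end MetricPreference

end

/-! The single-user matrix is `S * F`, up to reindexing rows, where row `j` of `F` lists the `D + d`
quadratic and linear monomials of `x_j`. Hence its rank is at most that of `S`, which is (1).

For (2), failure of full column rank is the vanishing of the Gram determinant, a polynomial in the
items. It is nonzero somewhere: place points that determine every quadratic without constant term at
the indices of `D + d` independent columns of `S`, and the origin elsewhere
(`exists_fullColumnRank`). On each line through that configuration only finitely many points are
bad, so Fubini makes the bad set null (`ae_mem_of_ae_line`).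

For (3), put `N = D + d` and draw the pairs one at a time. A new pair fails to raise a rank `r < N`
only if its row lies in the current row span, which contains at most `r (r + 1)` of the vectors
`s_(p,q)` (`card_pairs_mem_le`). The bound on `n` makes this at most a fraction `1 - 1/φ` of all
pairs, with `φ` the golden ratio, so the rank grows at least like a sum of Bernoulli(`1/φ`) trials.
A Chernoff bound, phrased as counting, finishes. -/

namespace MetricPreference

/-! ### Factorization through the features, and necessity of the rank condition -/

/-- The matrix `[X_⊗ᵀ Xᵀ]` of features of the items. -/
noncomputable def featureMatrix {n d : ℕ} (x : Fin n → EuclideanSpace ℝ (Fin d)) :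
    Matrix (Fin n) (UpperIndex d ⊕ Fin 1 × Fin d) ℝ :=
  Matrix.of fun j => Sum.elim (symSquare (x j)) (fun b => x j b.2)

theorem singleUserMatrix_eq {m n d : ℕ} (S : Matrix (Fin m) (Fin n) ℝ)
    (x : Fin n → EuclideanSpace ℝ (Fin d)) :
    singleUserMatrix S x = (S * featureMatrix x).submatrix (fun r => r.2) id := by
  ext r c
  rcases c with a | ⟨b, c⟩
  · simp [singleUserMatrix, measurementMatrix, featureMatrix, Matrix.mul_apply, itemTensorMatrix]
  · simp [singleUserMatrix, measurementMatrix, featureMatrix, Matrix.mul_apply, itemMatrix,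
      Subsingleton.elim b r.1]

theorem fullColumnRank_iff_mulVec {ι κ : Type*} [Fintype κ] (A : Matrix ι κ ℝ) :
    FullColumnRank A ↔ ∀ v, A *ᵥ v = 0 → v = 0 := by
  rw [FullColumnRank, ← Matrix.mulVec_injective_iff, ← Matrix.coe_mulVecLin]
  exact injective_iff_map_eq_zero _

theorem fullColumnRank_singleUserMatrix {m n d : ℕ} (S : Matrix (Fin m) (Fin n) ℝ)
    (x : Fin n → EuclideanSpace ℝ (Fin d)) :
    FullColumnRank (singleUserMatrix S x) ↔ FullColumnRank (S * featureMatrix x) := by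
  rw [fullColumnRank_iff_mulVec, fullColumnRank_iff_mulVec, singleUserMatrix_eq]
  refine forall_congr' fun v => imp_congr_left ?_
  constructor
  · intro h
    ext i
    exact congrFun h ⟨0, i⟩
  · intro h
    ext r
    exact congrFun h r.2

/-- Over the reals a matrix and its Gram matrix have the same kernel. This makes full rank a single
polynomial condition on the items, used both for measurability and for genericity. -/
theorem fullColumnRank_iff_det {ι κ : Type*} [Fintype ι] [Fintype κ] [DecidableEq κ]
    (A : Matrix ι κ ℝ) : FullColumnRank A ↔ (Aᵀ * A).det ≠ 0 := by
  rw [fullColumnRank_iff_mulVec, ← isUnit_iff_ne_zero, ← Matrix.isUnit_iff_isUnit_det,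
    ← Matrix.mulVec_injective_iff_isUnit, ← Matrix.coe_mulVecLin (Aᵀ * A),
    ← LinearMap.ker_eq_bot, Matrix.ker_mulVecLin_transpose_mul_self, LinearMap.ker_eq_bot']
  rfl

theorem card_featureIndex (d : ℕ) :
    Fintype.card (UpperIndex d ⊕ Fin 1 × Fin d) = metricDim d + d := by
  rw [Fintype.card_sum, card_upperIndex]
  simp

theorem le_rank_of_fullColumnRank {m n d : ℕ} (S : Matrix (Fin m) (Fin n) ℝ)
    (x : Fin n → EuclideanSpace ℝ (Fin d)) (h : FullColumnRank (singleUserMatrix S x)) :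
    metricDim d + d ≤ S.rank := by
  rw [fullColumnRank_singleUserMatrix] at h
  refine le_trans (le_of_eq ?_) (Matrix.rank_mul_le_left S (featureMatrix x))
  rw [← Matrix.rank_transpose, LinearIndependent.rank_matrix (by exact h), card_featureIndex]

/-! ### A configuration of items with full column rank -/

/-- Points at which the features are unisolvent. -/
noncomputable def basePoint {d : ℕ} : UpperIndex d ⊕ Fin 1 × Fin d → EuclideanSpace ℝ (Fin d) :=
  Sum.elim (fun a => EuclideanSpace.single a.1.1 1 + EuclideanSpace.single a.1.2 1)
    (fun b => EuclideanSpace.single b.2 1)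

/-- The quadratic function without constant term with coefficient vector `v`. -/
noncomputable def featureValue {d : ℕ} (v : UpperIndex d ⊕ Fin 1 × Fin d → ℝ)
    (x : EuclideanSpace ℝ (Fin d)) : ℝ :=
  ∑ a : UpperIndex d, x a.1.1 * x a.1.2 * v (.inl a) + ∑ c : Fin d, x c * v (.inr (0, c))

theorem featureMatrix_mulVec {n d : ℕ} (x : Fin n → EuclideanSpace ℝ (Fin d))
    (v : UpperIndex d ⊕ Fin 1 × Fin d → ℝ) (j : Fin n) :
    (featureMatrix x *ᵥ v) j = featureValue v (x j) := by
  simp [featureMatrix, featureValue, Matrix.mulVec, dotProduct, symSquare, Fintype.sum_prod_type]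

theorem featureValue_smul_single {d : ℕ} (v : UpperIndex d ⊕ Fin 1 × Fin d → ℝ) (t : ℝ)
    (c : Fin d) : featureValue v (t • EuclideanSpace.single c 1) =
      t ^ 2 * v (.inl ⟨(c, c), le_rfl⟩) + t * v (.inr (0, c)) := by
  unfold featureValue
  congr 1
  · rw [Finset.sum_eq_single ⟨(c, c), le_rfl⟩]
    · simp only [PiLp.smul_apply, PiLp.single_apply, if_true, smul_eq_mul]
      ring
    · rintro ⟨⟨a, b⟩, hab⟩ - h
      by_cases h1 : a = c
      · have h2 : b ≠ c := by rintro rfl; subst h1; exact h rfl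
        simp [h2]
      · simp [h1]
    · simp
  · rw [Finset.sum_eq_single c] <;> simp +contextual

theorem featureValue_single_add_single {d : ℕ} (v : UpperIndex d ⊕ Fin 1 × Fin d → ℝ)
    {a b : Fin d} (hab : a < b) :
    featureValue v (EuclideanSpace.single a 1 + EuclideanSpace.single b 1) =
      v (.inl ⟨(a, b), hab.le⟩) + featureValue v (EuclideanSpace.single a 1) +
        featureValue v (EuclideanSpace.single b 1) := by
  have key : ∀ c : UpperIndex d,
      ((EuclideanSpace.single a (1 : ℝ) + EuclideanSpace.single b 1 : EuclideanSpace ℝ (Fin d)) c.1.1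
        * (EuclideanSpace.single a (1 : ℝ) + EuclideanSpace.single b 1 :
          EuclideanSpace ℝ (Fin d)) c.1.2) * v (.inl c) =
      (if c = ⟨(a, b), hab.le⟩ then v (.inl c) else 0) +
      (EuclideanSpace.single a (1 : ℝ) : EuclideanSpace ℝ (Fin d)) c.1.1 *
        (EuclideanSpace.single a (1 : ℝ) : EuclideanSpace ℝ (Fin d)) c.1.2 * v (.inl c) +
      (EuclideanSpace.single b (1 : ℝ) : EuclideanSpace ℝ (Fin d)) c.1.1 *
        (EuclideanSpace.single b (1 : ℝ) : EuclideanSpace ℝ (Fin d)) c.1.2 * v (.inl c) := by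
    rintro ⟨⟨p, q⟩, hpq⟩
    have hpq' : p ≤ q := hpq
    simp only [PiLp.add_apply, PiLp.single_apply, Subtype.mk.injEq, Prod.mk.injEq]
    have hne : a ≠ b := hab.ne
    by_cases h1 : p = a <;> by_cases h2 : q = b <;> by_cases h3 : p = b <;> by_cases h4 : q = a <;>
      simp_all
    -- The remaining case is `(p, q) = (b, a)`, which lies below the diagonal.
    exact absurd hab (not_lt.2 hpq')
  unfold featureValue
  rw [Finset.sum_congr rfl fun c _ => key c]
  simp only [Finset.sum_add_distrib, Finset.sum_ite_eq', Finset.mem_univ, if_true,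
    PiLp.add_apply, add_mul]
  ring

/-- The base points include `e_c` and, from the diagonal index `(c, c)`, also `2 e_c`; these two
values separate the square coefficient from the linear one. The values at `e_a + e_b` then give the
mixed coefficients. -/
theorem eq_zero_of_featureValue_basePoint {d : ℕ} (v : UpperIndex d ⊕ Fin 1 × Fin d → ℝ)
    (h : ∀ i, featureValue v (basePoint i) = 0) : v = 0 := by
  have h1 : ∀ c, featureValue v (EuclideanSpace.single c 1) = 0 := fun c => h (.inr (0, c))
  have h2 : ∀ c, v (.inl ⟨(c, c), le_rfl⟩) = 0 ∧ v (.inr (0, c)) = 0 := by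
    intro c
    have e1 := featureValue_smul_single v 1 c
    have e2 := featureValue_smul_single v 2 c
    have e3 := h (.inl ⟨(c, c), le_rfl⟩)
    simp only [basePoint, Sum.elim_inl] at e3
    rw [two_smul, e3] at e2
    rw [one_smul, h1] at e1
    constructor <;> linarith
  ext i
  rcases i with ⟨⟨a, b⟩, hab⟩ | ⟨z, c⟩
  · rcases (show a ≤ b from hab).eq_or_lt with rfl | hlt
    · exact (h2 a).1
    · have := featureValue_single_add_single v hlt
      rw [h1, h1, add_zero, add_zero] at this
      rw [← this]
      exact h (.inl ⟨(a, b), hab⟩)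
  · rw [Subsingleton.elim z 0]
    exact (h2 c).2

theorem exists_linearIndependent_columns {m n : ℕ} {ι : Type*} [Fintype ι]
    (S : Matrix (Fin m) (Fin n) ℝ) (h : Fintype.card ι ≤ S.rank) :
    ∃ g : ι → Fin n, LinearIndependent ℝ fun i => S.col (g i) := by
  rw [Matrix.rank_eq_finrank_span_cols] at h
  obtain ⟨f, hf, -, hli⟩ := Submodule.exists_fun_fin_finrank_span_eq ℝ (Set.range S.col)
  choose g hg using hf
  let e : ι ↪ Fin _ := (Fintype.equivFin ι).toEmbedding.trans (Fin.castLEEmb h)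
  refine ⟨fun i => g (e i), ?_⟩
  simp only [hg]
  exact hli.comp _ e.injective

theorem exists_fullColumnRank {m n d : ℕ} (S : Matrix (Fin m) (Fin n) ℝ)
    (h : metricDim d + d ≤ S.rank) :
    ∃ x : Fin n → EuclideanSpace ℝ (Fin d), FullColumnRank (S * featureMatrix x) := by
  rw [← card_featureIndex] at h
  obtain ⟨g, hg⟩ := exists_linearIndependent_columns S h
  have hinj : Function.Injective g := fun a b hab => hg.injective (by simp [hab])
  -- All features vanish at the origin, so only the independent columns `g i` contribute, with
  -- coefficients `featureValue v (basePoint i)`.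
  refine ⟨Function.extend g basePoint 0, (fullColumnRank_iff_mulVec _).2 fun v hv => ?_⟩
  rw [← Matrix.mulVec_mulVec] at hv
  apply eq_zero_of_featureValue_basePoint
  rw [Fintype.linearIndependent_iff] at hg
  apply hg
  ext r
  have := congrFun hv r
  rw [Matrix.mulVec, dotProduct] at this
  refine Eq.trans ?_ this
  rw [Finset.sum_apply]
  rw [← Finset.sum_subset (Finset.subset_univ (Finset.univ.map ⟨g, hinj⟩)), Finset.sum_map]
  · refine Finset.sum_congr rfl fun i _ => ?_
    simp [featureMatrix_mulVec, hinj.extend_apply, mul_comm]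
  · intro j _ hj
    have : ¬ ∃ i, g i = j := by simpa using hj
    rw [featureMatrix_mulVec, Function.extend_apply' _ _ _ this]
    simp [featureValue]

/-! ### Genericity: almost every configuration is good -/

open Polynomial in
/-- The features along the line `x + t u`, as polynomials in `t`. -/
noncomputable def linePolynomial {n d : ℕ} (x u : Fin n → EuclideanSpace ℝ (Fin d)) :
    Matrix (Fin n) (UpperIndex d ⊕ Fin 1 × Fin d) ℝ[X] :=
  Matrix.of fun j => Sum.elim
    (fun a => (C (x j a.1.1) + X * C (u j a.1.1)) * (C (x j a.1.2) + X * C (u j a.1.2)))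
    (fun b => C (x j b.2) + X * C (u j b.2))

theorem map_linePolynomial {n d : ℕ} (x u : Fin n → EuclideanSpace ℝ (Fin d)) (t : ℝ) :
    (linePolynomial x u).map (Polynomial.evalRingHom t) = featureMatrix (x + t • u) := by
  ext j c
  rcases c with a | b <;> simp [linePolynomial, featureMatrix, symSquare, mul_comm t]

/-- Along the line the Gram determinant is a univariate polynomial in `t`, nonzero at `t = 0`. -/
theorem finite_not_fullColumnRank_line {m n d : ℕ} (S : Matrix (Fin m) (Fin n) ℝ)
    (x u : Fin n → EuclideanSpace ℝ (Fin d)) (h : FullColumnRank (S * featureMatrix x)) :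
    {t : ℝ | ¬ FullColumnRank (S * featureMatrix (x + t • u))}.Finite := by
  classical
  let A := S.map Polynomial.C * linePolynomial x u
  let p := (Aᵀ * A).det
  have hA (t : ℝ) : A.map (Polynomial.evalRingHom t) = S * featureMatrix (x + t • u) := by
    rw [Matrix.map_mul, map_linePolynomial]
    congr 1
    ext i j
    simp
  have hp (t : ℝ) : p.eval t =
      ((S * featureMatrix (x + t • u))ᵀ * (S * featureMatrix (x + t • u))).det := by
    rw [← Polynomial.coe_evalRingHom, RingHom.map_det, RingHom.mapMatrix_apply, Matrix.map_mul,
      Matrix.transpose_map, hA]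
  have hp0 : p ≠ 0 := by
    intro h0
    have := hp 0
    rw [zero_smul, add_zero, h0, Polynomial.eval_zero] at this
    exact (fullColumnRank_iff_det _).1 h this.symm
  refine (Polynomial.finite_setOfPred_isRoot hp0).subset fun t ht => ?_
  rw [Set.mem_ofPred_eq, fullColumnRank_iff_det, not_not, ← hp] at ht
  exact ht

theorem continuous_featureMatrix {n d : ℕ} :
    Continuous (featureMatrix : (Fin n → EuclideanSpace ℝ (Fin d)) → _) := by
  refine continuous_matrix fun j c => ?_
  rcases c with a | b
  · simp only [featureMatrix, symSquare, Matrix.of_apply, Sum.elim_inl]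
    fun_prop
  · simp only [featureMatrix, Matrix.of_apply, Sum.elim_inr]
    fun_prop

theorem measurableSet_fullColumnRank {m n d : ℕ} (S : Matrix (Fin m) (Fin n) ℝ) :
    MeasurableSet {x : Fin n → EuclideanSpace ℝ (Fin d) |
      FullColumnRank (S * featureMatrix x)} := by
  classical
  simp only [fullColumnRank_iff_det]
  have := continuous_featureMatrix (n := n) (d := d)
  refine (isOpen_ne.preimage (f := fun x : Fin n → EuclideanSpace ℝ (Fin d) =>
    ((S * featureMatrix x)ᵀ * (S * featureMatrix x)).det) ?_).measurableSet
  fun_prop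

/-- A measurable set containing almost all points of each line through a given point is conull. -/
theorem ae_mem_of_ae_line {E : Type*} [NormedAddCommGroup E] [NormedSpace ℝ E]
    [FiniteDimensional ℝ E] [MeasurableSpace E] [BorelSpace E] (μ : Measure E) [μ.IsAddHaarMeasure]
    {s : Set E} (hs : MeasurableSet s) (x : E) (h : ∀ u : E, ∀ᵐ t : ℝ, x + t • u ∈ s) :
    ∀ᵐ y ∂μ, y ∈ s := by
  have hm : MeasurableSet {z : E × ℝ | x + z.2 • z.1 ∈ s} := by
    refine hs.preimage (f := fun z : E × ℝ => x + z.2 • z.1) ?_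
    fun_prop
  have h2 := (Measure.ae_ae_comm (μ := μ) (ν := volume) (p := fun u t => x + t • u ∈ s) hm).1
    (ae_of_all _ h)
  -- By Fubini, almost every `t` is good for almost every direction `u`. For one such `t ≠ 0`, the
  -- map `u ↦ x + t u` only rescales Haar measure, so null sets transfer.
  obtain ⟨t, ht, ht0⟩ := (h2.and (Measure.ae_ne volume (0 : ℝ))).exists
  rw [ae_iff] at ht ⊢
  have e : {u | ¬ x + t • u ∈ s} = (fun u => t • u) ⁻¹' ((fun y => x + y) ⁻¹' {y | y ∉ s}) := rfl
  rw [e, Measure.addHaar_preimage_smul μ ht0, measure_preimage_add] at ht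
  simpa [ht0] using ht

theorem ae_fullColumnRank {m n d : ℕ} (S : Matrix (Fin m) (Fin n) ℝ)
    (h : metricDim d + d ≤ S.rank) :
    ∀ᵐ x : Fin n → EuclideanSpace ℝ (Fin d), FullColumnRank (S * featureMatrix x) := by
  obtain ⟨x, hx⟩ := exists_fullColumnRank S h
  refine ae_mem_of_ae_line volume (measurableSet_fullColumnRank S) x fun u => ?_
  rw [ae_iff]
  exact (finite_not_fullColumnRank_line S x u hx).measure_zero _

theorem pi_absolutelyContinuous {α : Type*} [MeasurableSpace α] {μ ν : Measure α} [SigmaFinite μ]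
    [SigmaFinite ν] (h : μ ≪ ν) (n : ℕ) :
    Measure.pi (fun _ : Fin n => μ) ≪ Measure.pi (fun _ : Fin n => ν) := by
  induction n with
  | zero => rw [Measure.pi_of_empty, Measure.pi_of_empty]
  | succ n ih =>
    rw [← (measurePreserving_piFinSuccAbove (fun _ : Fin (n + 1) => μ) 0).symm.map_eq,
      ← (measurePreserving_piFinSuccAbove (fun _ : Fin (n + 1) => ν) 0).symm.map_eq]
    exact (h.prod ih).map (MeasurableEquiv.measurable _)

theorem ae_fullColumnRank_items {Ω : Type*} [MeasurableSpace Ω] {P : Measure Ω}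
    [IsProbabilityMeasure P] {m n d : ℕ} (S : Matrix (Fin m) (Fin n) ℝ)
    {pX : Measure (EuclideanSpace ℝ (Fin d))} {X : Fin n → Ω → EuclideanSpace ℝ (Fin d)}
    (hpX : pX ≪ volume) (hX : IsIIDItems P pX X) (h : metricDim d + d ≤ S.rank) :
    ∀ᵐ ω ∂P, FullColumnRank (singleUserMatrix S fun j => X j ω) := by
  simp only [fullColumnRank_singleUserMatrix]
  -- For `n = 0` no item forces `pX` to be a probability measure, but there is only one
  -- configuration.
  rcases n.eq_zero_or_pos with rfl | hn
  · obtain ⟨x, hx⟩ := exists_fullColumnRank S h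
    exact ae_of_all _ fun ω => by rwa [Subsingleton.elim (fun j => X j ω) x]
  have : IsProbabilityMeasure pX := (hX.1 ⟨0, hn⟩).isProbabilityMeasure_iff.1 inferInstance
  have hlaw := hX.2.hasLaw_pi hX.1
  have hae := (pi_absolutelyContinuous hpX n).ae_le (ae_fullColumnRank S h)
  rw [← hlaw.map_eq] at hae
  exact ae_of_ae_map hlaw.aemeasurable hae

/-! ### Counting selection rows in a subspace -/

theorem selectionRow_eq {n : ℕ} {p q : Fin n} (h : p ≠ q) :
    selectionRow p q = Pi.single p 1 - Pi.single q 1 := by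
  ext j
  simp only [selectionRow, Pi.sub_apply, Pi.single_apply]
  by_cases h1 : j = p
  · simp [h1, h]
  · by_cases h2 : j = q <;> simp [h1, h2]
    simp [Ne.symm h]

/-- The vectors are independent: among them, only the one indexed by `p` has a nonzero coordinate at
`p ∈ T`. -/
theorem card_le_finrank {n : ℕ} (V : Submodule ℝ (Fin n → ℝ)) (T : Finset (Fin n))
    (r : Fin n → Fin n) (hr : ∀ p ∈ T, r p ∉ T)
    (hV : ∀ p ∈ T, (Pi.single p 1 - Pi.single (r p) 1 : Fin n → ℝ) ∈ V) :
    T.card ≤ Module.finrank ℝ V := by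
  let f : T → V := fun p => ⟨_, hV p p.2⟩
  have hf : LinearIndependent ℝ f := by
    rw [Fintype.linearIndependent_iff]
    intro g hg i
    have := congrFun (congrArg Subtype.val hg) i
    rw [AddSubmonoidClass.coe_finsetSum, Finset.sum_apply, Finset.sum_eq_single i] at this
    · have hi : (i : Fin n) ≠ r i := fun h => hr i i.2 (h ▸ i.2)
      simpa [f, hi] using this
    · intro j _ hj
      have h1 : (i : Fin n) ≠ j := fun h => hj (Subtype.ext h.symm)
      have h2 : (i : Fin n) ≠ r j := fun h => hr j j.2 (h ▸ i.2)
      simp [f, h1, h2]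
    · simp
  simpa using hf.fintype_card_le_finrank

/-- A subspace of dimension `r` contains at most `r (r + 1)` of the vectors `s_(p,q)`. -/
theorem card_pairs_mem_le {n : ℕ} (V : Submodule ℝ (Fin n → ℝ))
    [DecidablePred fun a : ItemPair n => selectionRow a.1.1 a.1.2 ∈ V] :
    (Finset.univ.filter fun a : ItemPair n => selectionRow a.1.1 a.1.2 ∈ V).card ≤
      Module.finrank ℝ V * (Module.finrank ℝ V + 1) := by
  classical
  -- Membership of `e_p - e_q` in `V` is an equivalence relation. Both the set `T` of
  -- non-representatives and any class with one point removed have at most `finrank V` elements.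
  let s : Setoid (Fin n) :=
    { r := fun p q => (Pi.single p 1 - Pi.single q 1 : Fin n → ℝ) ∈ V
      iseqv :=
        { refl := fun p => by simp
          symm := fun {p q} h => by simpa using V.neg_mem h
          trans := fun {p q r} h1 h2 => by simpa using V.add_mem h1 h2 } }
  let rep : Fin n → Fin n := fun p => (Quotient.mk s p).out
  have hrep (p : Fin n) : (Pi.single p 1 - Pi.single (rep p) 1 : Fin n → ℝ) ∈ V :=
    s.symm (Quotient.mk_out (s := s) p)
  have hrr {p q : Fin n} (h : s p q) : rep p = rep q := by
    simp only [rep]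
    rw [Quotient.sound h]
  have hidem (p : Fin n) : rep (rep p) = rep p := (hrr (hrep p)).symm
  let T : Finset (Fin n) := Finset.univ.filter fun p => rep p ≠ p
  have hT : T.card ≤ Module.finrank ℝ V := by
    refine card_le_finrank V T rep (fun p _ => ?_) fun p _ => hrep p
    simp [T, hidem]
  let U : Fin n → Finset (Fin n) := fun q => Finset.univ.filter fun p => p ≠ q ∧ s p q
  have hU (q : Fin n) : (U q).card ≤ Module.finrank ℝ V := by
    refine card_le_finrank V (U q) (fun _ => q) (fun p _ => by simp [U]) fun p hp => ?_
    exact (Finset.mem_filter.1 hp).2.2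
  have hsub : (Finset.univ.filter fun a : ItemPair n => selectionRow a.1.1 a.1.2 ∈ V).image
      Subtype.val ⊆ (T.image fun p => (p, rep p)) ∪
        T.biUnion fun q => (U q).image fun p => (p, q) := by
    intro z hz
    obtain ⟨⟨⟨p, q⟩, hpq⟩, ha, rfl⟩ := Finset.mem_image.1 hz
    have hpq' : p ≠ q := hpq
    have hs : s p q := by
      have := (Finset.mem_filter.1 ha).2
      rwa [selectionRow_eq hpq] at this
    rw [Finset.mem_union]
    -- If `q` is a representative, `p` determines the pair, giving at most `|T|` pairs. Otherwise `q
    -- ∈ T` and `p ∈ U q`, giving at most `|T| * finrank V`.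
    by_cases hq : rep q = q
    · left
      rw [Finset.mem_image]
      have : rep p = q := (hrr hs).trans hq
      exact ⟨p, by simp [T, this, hpq'.symm], by rw [this]⟩
    · right
      rw [Finset.mem_biUnion]
      exact ⟨q, by simp [T, hq], Finset.mem_image.2 ⟨p, by simp [U, hpq', hs], rfl⟩⟩
  rw [← Finset.card_image_of_injective _ Subtype.val_injective]
  calc _ ≤ _ := Finset.card_le_card hsub
    _ ≤ _ := Finset.card_union_le _ _
    _ ≤ T.card + T.card * Module.finrank ℝ V := by
        refine add_le_add Finset.card_image_le (Finset.card_biUnion_le_card_mul _ _ _ fun q _ => ?_)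
        exact Finset.card_image_le.trans (hU q)
    _ = T.card * (Module.finrank ℝ V + 1) := by ring
    _ ≤ _ := Nat.mul_le_mul_right _ hT

theorem card_itemPair (n : ℕ) : Fintype.card (ItemPair n) = n * n - n := by
  rw [Fintype.card_subtype]
  have := Finset.offDiag_card (Finset.univ : Finset (Fin n))
  rw [Finset.card_univ, Fintype.card_fin] at this
  rw [← this]
  congr 1
  ext a
  simp [Finset.mem_offDiag]

/-! ### Growth of the rank as pairs are added -/

/-- The span of the rows of a selection matrix. -/
def rowSpan {k n : ℕ} (e : Fin k → ItemPair n) : Submodule ℝ (Fin n → ℝ) :=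
  Submodule.span ℝ (Set.range fun i => selectionRow (e i).1.1 (e i).1.2)

theorem rank_selectionMatrix {k n : ℕ} (e : Fin k → ItemPair n) :
    (selectionMatrix e).rank = Module.finrank ℝ (rowSpan e) :=
  Matrix.rank_eq_finrank_span_row _

theorem rowSpan_cons {k n : ℕ} (a : ItemPair n) (e : Fin k → ItemPair n) :
    rowSpan (Fin.cons a e : Fin (k + 1) → ItemPair n) =
      rowSpan e ⊔ Submodule.span ℝ {selectionRow a.1.1 a.1.2} := by
  have : (fun i => selectionRow ((Fin.cons a e : Fin (k + 1) → ItemPair n) i).1.1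
      ((Fin.cons a e : Fin (k + 1) → ItemPair n) i).1.2) =
      Fin.cons (selectionRow a.1.1 a.1.2) fun i => selectionRow (e i).1.1 (e i).1.2 := by
    ext i
    refine Fin.cases ?_ (fun i => ?_) i <;> simp
  rw [rowSpan, this, Fin.range_cons, Submodule.span_insert, sup_comm, rowSpan]

theorem rank_cons {k n : ℕ} (a : ItemPair n) (e : Fin k → ItemPair n) :
    ((selectionRow a.1.1 a.1.2 ∈ rowSpan e) ∧
      (selectionMatrix (Fin.cons a e : Fin (k + 1) → ItemPair n)).rank =
        (selectionMatrix e).rank) ∨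
    ((selectionRow a.1.1 a.1.2 ∉ rowSpan e) ∧
      (selectionMatrix (Fin.cons a e : Fin (k + 1) → ItemPair n)).rank =
        (selectionMatrix e).rank + 1) := by
  simp only [rank_selectionMatrix]
  by_cases h : selectionRow a.1.1 a.1.2 ∈ rowSpan e
  · refine Or.inl ⟨h, ?_⟩
    rw [rowSpan_cons, sup_eq_left.2 ((Submodule.span_singleton_le_iff_mem _ _).2 h)]
  · refine Or.inr ⟨h, ?_⟩
    rw [rowSpan_cons, Submodule.finrank_sup_span_singleton h]

/-- The weight `t ^ r` of a rank `r < N`; ranks `N` and above have weight zero. -/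
def rankWeight (N : ℕ) (t : ℝ) (r : ℕ) : ℝ := if r < N then t ^ r else 0

/-- One step of the exponential moment: a raised rank multiplies the weight by at most `t`, and at
most a fraction `1 - p` of the pairs leaves it unchanged. The cutoff at `N` is what makes this
fraction uniform in the rank. -/
theorem sum_rankWeight_cons_le {N n k : ℕ} {t p : ℝ} (ht : 0 ≤ t) (ht1 : t ≤ 1)
    (hp : ((N - 1 : ℕ) : ℝ) * N ≤ (1 - p) * Fintype.card (ItemPair n)) (e : Fin k → ItemPair n) :
    ∑ a, rankWeight N t (selectionMatrix (Fin.cons a e : Fin (k + 1) → ItemPair n)).rank ≤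
      Fintype.card (ItemPair n) * (1 - p * (1 - t)) *
        rankWeight N t (selectionMatrix e).rank := by
  classical
  set r := (selectionMatrix e).rank with hr
  by_cases hrN : r < N
  · have hle : ∀ a, rankWeight N t
        (selectionMatrix (Fin.cons a e : Fin (k + 1) → ItemPair n)).rank ≤
        t ^ r * (t + if selectionRow a.1.1 a.1.2 ∈ rowSpan e then 1 - t else 0) := by
      intro a
      rcases rank_cons a e with ⟨h1, h2⟩ | ⟨h1, h2⟩
      · rw [h2, ← hr, rankWeight, if_pos hrN, if_pos h1]
        simp
      · rw [h2, ← hr, rankWeight, if_neg h1, add_zero, ← pow_succ]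
        split_ifs
        · exact le_rfl
        · positivity
    refine (Finset.sum_le_sum fun a _ => hle a).trans ?_
    rw [← Finset.mul_sum, Finset.sum_add_distrib, ← Finset.sum_filter, Finset.sum_const,
      Finset.sum_const, Finset.card_univ, nsmul_eq_mul, nsmul_eq_mul, rankWeight, if_pos hrN,
      mul_comm (t ^ r)]
    refine mul_le_mul_of_nonneg_right ?_ (pow_nonneg ht r)
    have hc := card_pairs_mem_le (rowSpan e)
    rw [← rank_selectionMatrix, ← hr] at hc
    have hc' : ((Finset.univ.filter fun a : ItemPair n =>
        selectionRow a.1.1 a.1.2 ∈ rowSpan e).card : ℝ) ≤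
        (1 - p) * Fintype.card (ItemPair n) := by
      refine le_trans ?_ hp
      exact_mod_cast hc.trans (Nat.mul_le_mul (by omega) (by omega))
    nlinarith [mul_le_mul_of_nonneg_right hc' (sub_nonneg.2 ht1)]
  · have h0 : ∀ a, rankWeight N t
        (selectionMatrix (Fin.cons a e : Fin (k + 1) → ItemPair n)).rank = 0 := by
      intro a
      rcases rank_cons a e with ⟨-, h2⟩ | ⟨-, h2⟩ <;> rw [h2, rankWeight, if_neg (by omega)]
    rw [rankWeight, if_neg hrN]
    simp [h0]

theorem sum_rankWeight_succ {N n k : ℕ} (t : ℝ) :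
    ∑ e : Fin (k + 1) → ItemPair n, rankWeight N t (selectionMatrix e).rank =
      ∑ e : Fin k → ItemPair n, ∑ a,
        rankWeight N t (selectionMatrix (Fin.cons a e : Fin (k + 1) → ItemPair n)).rank := by
  rw [← (Fin.consEquiv fun _ => ItemPair n).sum_comp, Fintype.sum_prod_type_right]
  rfl

theorem selectionRow_ne_zero {n : ℕ} (a : ItemPair n) : selectionRow a.1.1 a.1.2 ≠ 0 := by
  intro h
  have := congrFun h a.1.1
  simp [selectionRow] at this

/-- The first pair always raises the rank from 0 to 1, so it contributes the exact factor `t`; `2 ≤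
N` keeps that weight below the cutoff. -/
theorem sum_rankWeight_le {N n : ℕ} {t p : ℝ} (hN : 2 ≤ N) (ht : 0 ≤ t) (ht1 : t ≤ 1)
    (hc : 0 ≤ 1 - p * (1 - t))
    (hp : ((N - 1 : ℕ) : ℝ) * N ≤ (1 - p) * Fintype.card (ItemPair n)) (k : ℕ) :
    ∑ e : Fin (k + 1) → ItemPair n, rankWeight N t (selectionMatrix e).rank ≤
      (Fintype.card (ItemPair n) : ℝ) ^ (k + 1) * (1 - p * (1 - t)) ^ k * t := by
  induction k with
  | zero =>
    rw [sum_rankWeight_succ, Fintype.sum_unique]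
    have h1 : ∀ a, rankWeight N t
        (selectionMatrix (Fin.cons a default : Fin (0 + 1) → ItemPair n)).rank = t := by
      intro a
      have h0 : rowSpan (default : Fin 0 → ItemPair n) = ⊥ := by simp [rowSpan]
      have hr0 : (selectionMatrix (default : Fin 0 → ItemPair n)).rank = 0 := by
        rw [rank_selectionMatrix, h0, finrank_bot]
      rcases rank_cons a (default : Fin 0 → ItemPair n) with ⟨h, -⟩ | ⟨-, h⟩
      · rw [h0, Submodule.mem_bot] at h
        exact absurd h (selectionRow_ne_zero a)
      · rw [h, hr0, rankWeight, if_pos (by omega), zero_add, pow_one]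
    simp [h1]
  | succ k ih =>
    rw [sum_rankWeight_succ]
    refine (Finset.sum_le_sum fun e _ => sum_rankWeight_cons_le ht ht1 hp e).trans ?_
    rw [← Finset.mul_sum]
    refine (mul_le_mul_of_nonneg_left ih (by positivity)).trans (le_of_eq ?_)
    ring

/-- Markov's inequality: each rank below `N` has weight at least `t ^ (N - 1)`. Cancelling the
factor `t` of the first pair leaves the exponent `N - 2`. -/
theorem card_rank_lt_le {N n : ℕ} {t p : ℝ} (hN : 2 ≤ N) (ht : 0 < t) (ht1 : t ≤ 1)
    (hc : 0 ≤ 1 - p * (1 - t))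
    (hp : ((N - 1 : ℕ) : ℝ) * N ≤ (1 - p) * Fintype.card (ItemPair n)) (k : ℕ)
    [DecidablePred fun e : Fin (k + 1) → ItemPair n => (selectionMatrix e).rank < N] :
    t ^ (N - 2) * ((Finset.univ.filter fun e : Fin (k + 1) → ItemPair n =>
        (selectionMatrix e).rank < N).card : ℝ) ≤
      (Fintype.card (ItemPair n) : ℝ) ^ (k + 1) * (1 - p * (1 - t)) ^ k := by
  have h := sum_rankWeight_le hN ht.le ht1 hc hp k
  refine le_of_mul_le_mul_right (le_trans ?_ h) ht
  calc _ = t ^ (N - 1) * ((Finset.univ.filter fun e : Fin (k + 1) → ItemPair n =>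
        (selectionMatrix e).rank < N).card : ℝ) := by
        rw [show N - 1 = N - 2 + 1 by omega]; ring
    _ = ∑ e ∈ Finset.univ.filter (fun e : Fin (k + 1) → ItemPair n =>
        (selectionMatrix e).rank < N), t ^ (N - 1) := by
        rw [Finset.sum_const, nsmul_eq_mul, mul_comm]
    _ ≤ ∑ e ∈ Finset.univ.filter (fun e : Fin (k + 1) → ItemPair n =>
        (selectionMatrix e).rank < N), t ^ (selectionMatrix e).rank := by
        refine Finset.sum_le_sum fun e he => ?_
        have := (Finset.mem_filter.1 he).2
        exact pow_le_pow_of_le_one ht.le ht1 (by omega)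
    _ = _ := by
        rw [Finset.sum_filter]
        refine Finset.sum_congr rfl fun e _ => ?_
        rw [rankWeight]
        split_ifs <;> rfl

/-! ### Chernoff estimate and the golden ratio constants -/

/-- Apply `1 + x ≤ exp x` to both factors: the exponents are at most `j L` and `-L (j + 1)`. -/
theorem chernoff_bound {L p : ℝ} {j k : ℕ} (hL : 0 ≤ L) (hp : 0 ≤ p) (hp1 : p ≤ 1)
    (h : (1 + L) * (j + 1) ≤ p * k) :
    (1 + L) ^ j * (1 - p * (1 - 1 / (1 + L))) ^ k ≤ Real.exp (-L) := by
  have h1L : 0 < 1 + L := by linarith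
  have hq : 1 - 1 / (1 + L) = L / (1 + L) := by field_simp; ring
  have hq0 : 0 ≤ L / (1 + L) := by positivity
  have hq1 : L / (1 + L) ≤ 1 := by rw [div_le_one h1L]; linarith
  rw [hq]
  have hnn : 0 ≤ 1 - p * (L / (1 + L)) := by nlinarith
  have e1 : (1 + L) ^ j ≤ Real.exp (j * L) := by
    rw [Real.exp_nat_mul]
    exact pow_le_pow_left₀ h1L.le (by linarith [Real.add_one_le_exp L]) j
  have e2 : (1 - p * (L / (1 + L))) ^ k ≤ Real.exp (-(L * (j + 1))) := by
    calc _ ≤ Real.exp (-(p * (L / (1 + L)))) ^ k :=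
          pow_le_pow_left₀ hnn (by linarith [Real.add_one_le_exp (-(p * (L / (1 + L))))]) k
      _ = Real.exp (k * -(p * (L / (1 + L)))) := (Real.exp_nat_mul _ _).symm
      _ ≤ _ := by
          rw [Real.exp_le_exp]
          have := mul_le_mul_of_nonneg_left h hq0
          have e : L / (1 + L) * ((1 + L) * (j + 1)) = L * (j + 1) := by field_simp
          linarith
  calc _ ≤ Real.exp (j * L) * Real.exp (-(L * (j + 1))) :=
        mul_le_mul e1 e2 (pow_nonneg hnn k) (Real.exp_pos _).le
    _ = _ := by rw [← Real.exp_add]; congr 1; ring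

theorem two_le_metricDim_add {d : ℕ} (hd : 1 ≤ d) : 2 ≤ metricDim d + d := by
  have : 1 ≤ metricDim d := by
    rw [metricDim, Nat.le_div_iff_mul_le (by norm_num)]
    nlinarith
  omega

/-- The hypothesis gives `n (n - 1) ≥ φ² N²`, and `φ² = φ + 1` gives `1 - 1/φ = 1/φ²`. This identity
is why one constant serves both for `n` and for `m`. -/
theorem mul_le_card_itemPair {N n : ℕ} (hN : 2 ≤ N)
    (hn : Real.goldenRatio * N + 1 ≤ n) :
    ((N - 1 : ℕ) : ℝ) * N ≤ (1 - 1 / Real.goldenRatio) * Fintype.card (ItemPair n) := by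
  have hφ := Real.goldenRatio_pos
  have hφ1 := Real.one_lt_goldenRatio
  have hsq := Real.goldenRatio_sq
  rw [card_itemPair, Nat.cast_sub (Nat.le_mul_self n), Nat.cast_sub (by omega)]
  have e : 1 - 1 / Real.goldenRatio = 1 / Real.goldenRatio ^ 2 := by
    have h1 : 1 / Real.goldenRatio = Real.goldenRatio - 1 := by
      rw [div_eq_iff hφ.ne']
      linarith
    rw [eq_div_iff (by positivity), h1]
    linear_combination (1 - Real.goldenRatio) * hsq
  rw [e, div_mul_eq_mul_div, one_mul, le_div_iff₀ (by positivity)]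
  push_cast
  have hN0 : (0 : ℝ) ≤ N := Nat.cast_nonneg N
  have h1 : Real.goldenRatio * N * (Real.goldenRatio * N) ≤ n * (n - 1 : ℝ) :=
    mul_le_mul (by linarith) (by linarith) (by positivity) (Nat.cast_nonneg n)
  nlinarith [mul_nonneg (sq_nonneg Real.goldenRatio) hN0]

/-! ### From counting to probability -/

theorem measureReal_pairs {Ω : Type*} [MeasurableSpace Ω] {P : Measure Ω}
    [IsProbabilityMeasure P] {m n : ℕ} {e : Fin m → Ω → ItemPair n}
    (he : IsIIDUniformPairs P e) (s : Finset (Fin m → ItemPair n)) :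
    P.real {ω | (fun i => e i ω) ∈ s} = s.card / (Fintype.card (ItemPair n) : ℝ) ^ m := by
  have hlaw := he.2.hasLaw_pi he.1
  have hμ : ∀ a : ItemPair n, uniformOn (Set.univ : Set (ItemPair n)) {a} =
      (Fintype.card (ItemPair n) : ENNReal)⁻¹ := by
    intro a
    rw [uniformOn_univ, Measure.count_singleton, one_div]
  rw [hlaw.measureReal_eq (p := fun f => f ∈ s) s.measurableSet, Finset.setOfPred_mem,
    ← sum_measureReal_singleton]
  have : ∀ f : Fin m → ItemPair n,
      (Measure.pi fun _ : Fin m => uniformOn (Set.univ : Set (ItemPair n))).real {f} =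
        ((Fintype.card (ItemPair n) : ℝ) ^ m)⁻¹ := by
    intro f
    rw [measureReal_def, Measure.pi_singleton]
    simp only [hμ, Finset.prod_const, Finset.card_univ, Fintype.card_fin, ENNReal.toReal_pow,
      ENNReal.toReal_inv, ENNReal.toReal_natCast, inv_pow]
  rw [Finset.sum_congr rfl fun f _ => this f, Finset.sum_const, nsmul_eq_mul, div_eq_mul_inv]

theorem rank_random_selectionMatrix {Ω : Type*} [MeasurableSpace Ω] {P : Measure Ω}
    [IsProbabilityMeasure P] {m n N : ℕ} {δ : ℝ} (hδ : 0 < δ) (hδ1 : δ < 1) (hN : 2 ≤ N)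
    (hn : Real.goldenRatio * N + 1 ≤ n)
    (hm : Real.goldenRatio * (1 + Real.log (1 / δ)) * (N - 1) + 1 ≤ m)
    {e : Fin m → Ω → ItemPair n} (he : IsIIDUniformPairs P e) :
    1 - δ ≤ P.real {ω | N ≤ (selectionMatrix fun i => e i ω).rank} := by
  classical
  have hφ := Real.goldenRatio_pos
  have hφ1 := Real.one_lt_goldenRatio
  have hL : 0 < Real.log (1 / δ) := Real.log_pos (by rw [lt_div_iff₀ hδ]; linarith)
  set L := Real.log (1 / δ) with hLdef
  have hexp : Real.exp (-L) = δ := by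
    rw [hLdef, one_div, Real.log_inv, neg_neg, Real.exp_log hδ]
  have hN' : (2 : ℝ) ≤ N := by exact_mod_cast hN
  have hpos : 0 < Real.goldenRatio * (1 + L) * (N - 1) := by
    have : (0 : ℝ) < N - 1 := by linarith
    positivity
  -- The first pair is split off; the other `k` satisfy `k ≥ φ (1 + L) (N - 1)`.
  obtain ⟨k, rfl⟩ : ∃ k, m = k + 1 := by
    refine Nat.exists_eq_succ_of_ne_zero ?_
    rintro rfl
    rw [Nat.cast_zero] at hm
    linarith
  have hp := mul_le_card_itemPair hN hn
  have hE : (0 : ℝ) < Fintype.card (ItemPair n) := by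
    rw [Nat.cast_sub (by omega)] at hp
    have h1 : 0 < 1 - 1 / Real.goldenRatio := by
      rw [sub_pos, div_lt_one hφ]; exact hφ1
    refine pos_of_mul_pos_right (lt_of_lt_of_le ?_ hp) h1.le
    push_cast
    nlinarith
  have hp0 : 0 ≤ 1 / Real.goldenRatio := by positivity
  have hp1 : 1 / Real.goldenRatio ≤ 1 := by rw [div_le_one hφ]; exact hφ1.le
  -- The Chernoff parameter is `t = 1 / (1 + L)`.
  have ht : 0 < 1 / (1 + L) := by positivity
  have ht1 : 1 / (1 + L) ≤ 1 := by rw [div_le_one (by linarith)]; linarith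
  have hc : 0 ≤ 1 - 1 / Real.goldenRatio * (1 - 1 / (1 + L)) := by nlinarith
  have hcard := card_rank_lt_le hN ht ht1 hc hp k
  have hcher : (1 + L) ^ (N - 2) *
      (1 - 1 / Real.goldenRatio * (1 - 1 / (1 + L))) ^ k ≤ δ := by
    rw [← hexp]
    refine chernoff_bound hL.le hp0 hp1 ?_
    rw [Nat.cast_sub hN, one_div, inv_mul_eq_div, le_div_iff₀ hφ]
    push_cast at hm ⊢
    linarith
  have hbad := measureReal_pairs he
    (Finset.univ.filter fun e : Fin (k + 1) → ItemPair n => (selectionMatrix e).rank < N)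
  have hgood := measureReal_pairs he
    (Finset.univ.filter fun e : Fin (k + 1) → ItemPair n => ¬ (selectionMatrix e).rank < N)
  have htot := Finset.card_filter_add_card_filter_not (s := Finset.univ)
    (fun e : Fin (k + 1) → ItemPair n => (selectionMatrix e).rank < N)
  rw [Finset.card_univ, Fintype.card_fun, Fintype.card_fin] at htot
  have htot' : ((Finset.univ.filter fun e : Fin (k + 1) → ItemPair n =>
      (selectionMatrix e).rank < N).card : ℝ) + (Finset.univ.filter
      fun e : Fin (k + 1) → ItemPair n => ¬ (selectionMatrix e).rank < N).card =
      (Fintype.card (ItemPair n) : ℝ) ^ (k + 1) := by exact_mod_cast htot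
  simp only [Finset.mem_filter, Finset.mem_univ, true_and, not_lt] at hgood htot'
  rw [hgood, le_div_iff₀ (by positivity)]
  set B : ℝ := ((Finset.univ.filter fun e : Fin (k + 1) → ItemPair n =>
      (selectionMatrix e).rank < N).card : ℝ)
  have hB : B ≤ δ * (Fintype.card (ItemPair n) : ℝ) ^ (k + 1) := by
    calc B = (1 + L) ^ (N - 2) * ((1 / (1 + L)) ^ (N - 2) * B) := by
          rw [← mul_assoc, ← mul_pow, mul_one_div_cancel (by linarith), one_pow, one_mul]
      _ ≤ (1 + L) ^ (N - 2) * ((Fintype.card (ItemPair n) : ℝ) ^ (k + 1) *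
            (1 - 1 / Real.goldenRatio * (1 - 1 / (1 + L))) ^ k) :=
          mul_le_mul_of_nonneg_left hcard (by positivity)
      _ = (1 + L) ^ (N - 2) * (1 - 1 / Real.goldenRatio * (1 - 1 / (1 + L))) ^ k *
            (Fintype.card (ItemPair n) : ℝ) ^ (k + 1) := by ring
      _ ≤ _ := mul_le_mul_of_nonneg_right hcher (by positivity)
  linarith

end MetricPreference

theorem mainTheorem6 (d n : ℕ) (hd : 1 ≤ d) :
    -- deterministic necessity, for every choice of the items
    (∀ (m : ℕ) (S : Matrix (Fin m) (Fin n) ℝ), MetricPreference.IsSelectionMatrix S →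
      ∀ x : Fin n → EuclideanSpace ℝ (Fin d),
        MetricPreference.FullColumnRank (MetricPreference.singleUserMatrix S x) →
          MetricPreference.metricDim d + d ≤ S.rank) ∧
    -- almost sure characterization for a fixed selection matrix
    (∀ (m : ℕ) (S : Matrix (Fin m) (Fin n) ℝ), MetricPreference.IsSelectionMatrix S →
      ∀ (Ω : Type*) [MeasurableSpace Ω] (P : Measure Ω) [IsProbabilityMeasure P]
        (pX : Measure (EuclideanSpace ℝ (Fin d))) (X : Fin n → Ω → EuclideanSpace ℝ (Fin d)),
        pX ≪ volume → MetricPreference.IsIIDItems P pX X →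
          ((∀ᵐ ω ∂P, MetricPreference.FullColumnRank
              (MetricPreference.singleUserMatrix S (fun j => X j ω))) ↔
            MetricPreference.metricDim d + d ≤ S.rank)) ∧
    -- random pairs
    (∀ (δ : ℝ) (m : ℕ), 0 < δ → δ < 1 →
      (1 + √5) / 2 * ((MetricPreference.metricDim d : ℝ) + d) + 1 ≤ (n : ℝ) →
      ⌈(1 + √5) / 2 * (1 + Real.log (1 / δ)) *
        ((MetricPreference.metricDim d : ℝ) + d - 1)⌉ + 1 ≤ (m : ℤ) →
      ∀ (Ω : Type*) [MeasurableSpace Ω] (P : Measure Ω) [IsProbabilityMeasure P]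
        (e : Fin m → Ω → MetricPreference.ItemPair n),
        MetricPreference.IsIIDUniformPairs P e →
          1 - δ ≤ P.real {ω | MetricPreference.metricDim d + d ≤
            (MetricPreference.selectionMatrix (fun i => e i ω)).rank} ∧
          -- items drawn independently of the pairs
          ∀ (pX : Measure (EuclideanSpace ℝ (Fin d)))
            (X : Fin n → Ω → EuclideanSpace ℝ (Fin d)),
            pX ≪ volume → MetricPreference.IsIIDItems P pX X →
            IndepFun (fun ω i => e i ω) (fun ω j => X j ω) P →
              1 - δ ≤ P.real {ω | MetricPreference.FullColumnRank
                (MetricPreference.singleUserMatrix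
                  (MetricPreference.selectionMatrix (fun i => e i ω)) (fun j => X j ω))}) := by
  refine ⟨fun m S _ x h => MetricPreference.le_rank_of_fullColumnRank S x h, ?_, ?_⟩
  · intro m S _ Ω _ P _ pX X hpX hX
    refine ⟨fun h => ?_, MetricPreference.ae_fullColumnRank_items S hpX hX⟩
    obtain ⟨ω, hω⟩ := h.exists
    exact MetricPreference.le_rank_of_fullColumnRank S _ hω
  · intro δ m hδ hδ1 hn hm Ω _ P _ e he
    have hm' : Real.goldenRatio * (1 + Real.log (1 / δ)) *
        ((MetricPreference.metricDim d + d : ℕ) - 1) + 1 ≤ (m : ℝ) := by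
      have h1 := Int.le_ceil ((1 + √5) / 2 * (1 + Real.log (1 / δ)) *
        ((MetricPreference.metricDim d : ℝ) + d - 1))
      have h2 : ((⌈(1 + √5) / 2 * (1 + Real.log (1 / δ)) *
        ((MetricPreference.metricDim d : ℝ) + d - 1)⌉ : ℤ) : ℝ) + 1 ≤ (m : ℝ) := by
        exact_mod_cast hm
      rw [Real.goldenRatio]
      push_cast
      linarith
    have hrank := MetricPreference.rank_random_selectionMatrix hδ hδ1
      (MetricPreference.two_le_metricDim_add hd)
      (by rw [Real.goldenRatio]; push_cast; exact hn) hm' he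
    refine ⟨hrank, fun pX X hpX hX _ => hrank.trans ?_⟩
    -- There are finitely many sequences of pairs, so one null set serves all of them and the
    -- fixed-matrix result applies to the random one.
    have hae : ∀ᵐ ω ∂P, ∀ f : Fin m → MetricPreference.ItemPair n,
        MetricPreference.metricDim d + d ≤ (MetricPreference.selectionMatrix f).rank →
          MetricPreference.FullColumnRank (MetricPreference.singleUserMatrix
            (MetricPreference.selectionMatrix f) fun j => X j ω) := by
      rw [ae_all_iff]
      intro f
      rw [ae_all_iff]
      exact MetricPreference.ae_fullColumnRank_items _ hpX hX
    refine ENNReal.toReal_mono (measure_ne_top _ _) (measure_mono_ae ?_)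
    filter_upwards [hae] with ω hω h
    exact hω _ h
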